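/- Let $R$ be a commutative noetherian ring, and write $\otimes=\otimes_R$ and $M^*=\operatorname{Hom}_R(M,R)$. Algebras are associative and unital, not necessarily commutative. A submodule $N\subseteq M$ is \emph{pure} if $N\otimes X\to M\otimes X$ is injective for every $R$-module $X$. For an $R$-algebra $A$ let $$A^\circ=\{f\in A^*\mid Af \text{ is a finitely generated } R\text{-module}\},\qquad (af)(b)=f(ba),$$ regarded as a submodule of the module $R^A$ of all maps $A\to R$. A \emph{subcoalgebra} of an $R$-coalgebra $E$ is a pure submodule $D\subseteq E$ with $\Delta(D)\subseteq D\otimes D$. A bilinear form $\langle-,-\rangle:C\times A\to R$ is a \emph{rational system} if for every $R$-module $M$ the map $\alpha_M:M\otimes C\to\operatorname{Hom}_R(A,M)$, $m\otimes c\mapsto[a\mapsto\langle c,a\rangle m]$, is injective. It is a \emph{rational pairing} if moreover $C$ is an $R$-coalgebra, $A$ is an $R$-algebra, and $A\to C^*$, $a\mapsto\langle-,a\rangle$, is a morphism of $R$-algebras, where $C^*$ has the convolution product. Let $A$ be an $R$-algebra such that $A^\circ$ is pure in $R^A$. Then: \begin{enumerate} \item $A^\circ$ is an $R$-coalgebra: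 there is a unique $R$-coalgebra structure on $A^\circ$ with $\epsilon(f)=f(1)$ and $f(ab)=\sum f_1(a)f_2(b)$ for all $f\in A^\circ$ and $a,b\in A$, where $\Delta(f)=\sum f_1\otimes f_2$. If in addition $A$ is a bialgebra, then $A^\circ$, with this coalgebra structure, is a bialgebra, with the unit and multiplication of the convolution algebra $A^*$. If $A$ is a Hopf algebra with antipode $S$, then this bialgebra is a Hopf algebra, with antipode $f\mapsto f\circ S$. \item Let $B$ be an $R$-algebra such that $B^\circ$ is pure in $R^B$. For every morphism of $R$-algebras $\varphi:A\to B$ we have $\varphi^*(B^\circ)\subseteq A^\circ$, where $\varphi^*(f)=f\circ\varphi$, and $\varphi^\circ:=\varphi^*|_{B^\circ}:B^\circ\to A^\circ$ is a morphism of $R$-coalgebras. \item Let $C\subseteq A^\circ$ be a subcoalgebra. Then $C$ has a unique $R$-coalgebra structure for which the inclusion $C\to A^\circ$ is a coalgebra morphism, and with it $(C,A,\langle-,-\rangle)$, where $\langle f,a\rangle=f(a)$, is a rational pairing. \item If $(C,A,\langle-,-\rangle)$ is a rational pairing, then $C$ is an $R$-subcoalgebra of $A^\circ$: the map $c\mapsto\langle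 c,-\rangle$ is an injective morphism of $R$-coalgebras $C\to A^\circ$, whose image is a subcoalgebra of $A^\circ$. \end{enumerate} -/

import Mathlib

open scoped TensorProduct

/-- A submodule `N ⊆ M` is pure if `N ⊗ X → M ⊗ X` is injective for every `R`-module `X`.
The universe `w` of the modules `X` is a parameter. Since every module is the directed union of its
finitely generated submodules, the case `w = u` (the universe of `R`) implies all others; it is the
one used where purity is assumed, and `w` is arbitrary where purity is concluded. -/
def IsPureSubmodule.{w, u, v} {R : Type u} {M : Type v} [CommRing R] [AddCommMonoid M]
    [Module R M] (N : Submodule R M) : Prop :=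
  ∀ (X : Type w) [AddCommGroup X] [Module R X],
    Function.Injective (LinearMap.rTensor X N.subtype)

section RationalPairings

universe w u v t

variable {R : Type u} {P : Type v} {A : Type t} [CommRing R]

/-- The map `α_M : M ⊗ P → Hom_R(A, M)`, `m ⊗ p ↦ (a ↦ ⟨p, a⟩ m)`, of a bilinear form `⟨-,-⟩`. -/
noncomputable def pairingMap [AddCommMonoid P] [Module R P] [AddCommGroup A] [Module R A]
    (β : P →ₗ[R] A →ₗ[R] R) (M : Type w) [AddCommGroup M] [Module R M] :
    M ⊗[R] P →ₗ[R] (A →ₗ[R] M) :=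
  TensorProduct.lift (LinearMap.smulRightₗ ∘ₗ β).flip

theorem pairingMap_tmul_apply [AddCommMonoid P] [Module R P] [AddCommGroup A] [Module R A]
    (β : P →ₗ[R] A →ₗ[R] R) (M : Type w) [AddCommGroup M] [Module R M] (m : M) (p : P) (a : A) :
    pairingMap β M (m ⊗ₜ[R] p) a = β p a • m := by
  simp [pairingMap]

/-- `(P, A, ⟨-,-⟩)` is a rational system if `α_M` is injective for every `R`-module `M`.
As for purity, `w = u` is used where this is assumed, and `w` is arbitrary where it is concluded. -/
def IsRationalSystem [AddCommMonoid P] [Module R P] [AddCommGroup A] [Module R A]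
    (β : P →ₗ[R] A →ₗ[R] R) : Prop :=
  ∀ (M : Type w) [AddCommGroup M] [Module R M], Function.Injective (pairingMap β M)

/-- `(C, A, ⟨-,-⟩)`, with `C` a coalgebra and `A` an algebra, is a rational pairing if it is a
rational system and `a ↦ ⟨-, a⟩` is an algebra morphism from `A` to the convolution algebra
`C^*`. -/
structure IsRationalPairing [AddCommMonoid P] [Module R P] [Coalgebra R P] [Ring A] [Algebra R A]
    (β : P →ₗ[R] A →ₗ[R] R) : Prop where
  rationalSystem : IsRationalSystem.{w} β
  algHom : ∃ φ : A →ₐ[R] WithConv (P →ₗ[R] R), ∀ a c, φ a c = β c a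

/-- A subcoalgebra of a coalgebra `E` is a pure submodule `D` such that `Δ(D) ⊆ D ⊗ D`. -/
structure IsSubcoalgebra [AddCommMonoid P] [Module R P] [Coalgebra R P]
    (D : Submodule R P) : Prop where
  pure : IsPureSubmodule.{w} D
  comul_mem : ∀ d ∈ D, Coalgebra.comul (R := R) d ∈
    LinearMap.range (TensorProduct.map D.subtype D.subtype)

end RationalPairings

/-- The submodule `A f` of `A^*`, where `(a f)(b) = f (b a)`. -/
def dualOrbit (R : Type*) {A : Type*} [CommRing R] [Ring A] [Algebra R A]
    (f : A →ₗ[R] R) : Submodule R (A →ₗ[R] R) :=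
  LinearMap.range ((LinearMap.mul R A).flip.compr₂ f)

theorem mem_dualOrbit {R A : Type*} [CommRing R] [Ring A] [Algebra R A] {f g : A →ₗ[R] R} :
    g ∈ dualOrbit R f ↔ ∃ a : A, ∀ b : A, g b = f (b * a) := by
  constructor
  · rintro ⟨a, rfl⟩
    exact ⟨a, fun b => rfl⟩
  · rintro ⟨a, h⟩
    exact ⟨a, LinearMap.ext fun b => (h b).symm⟩

/-- The finite dual `A° = {f ∈ A^* | A f is finitely generated as an R-module}` of an algebra
`A` over a noetherian ring `R`. -/
def finiteDual (R A : Type*) [CommRing R] [IsNoetherianRing R] [Ring A] [Algebra R A] :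
    Submodule R (A →ₗ[R] R) where
  carrier := {f | (dualOrbit R f).FG}
  zero_mem' := by
    have h : dualOrbit R (0 : A →ₗ[R] R) = ⊥ := by
      refine le_bot_iff.1 fun g hg => ?_
      obtain ⟨a, ha⟩ := mem_dualOrbit.1 hg
      exact (Submodule.mem_bot R).2 (LinearMap.ext fun b => by simp [ha])
    simpa [h] using (Submodule.fg_bot (R := R) (M := A →ₗ[R] R))
  add_mem' := by
    intro f g hf hg
    have hfg : (dualOrbit R f ⊔ dualOrbit R g).FG := Submodule.FG.sup hf hg
    have := isNoetherian_of_fg_of_noetherian _ hfg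
    refine (isNoetherian_submodule.1 this) _ fun k hk => ?_
    obtain ⟨a, ha⟩ := mem_dualOrbit.1 hk
    refine Submodule.mem_sup.2 ⟨_, ⟨a, rfl⟩, _, ⟨a, rfl⟩, ?_⟩
    ext b
    simp [ha]
  smul_mem' := by
    intro r f hf
    have := isNoetherian_of_fg_of_noetherian _ hf
    refine (isNoetherian_submodule.1 this) _ fun k hk => ?_
    obtain ⟨a, ha⟩ := mem_dualOrbit.1 hk
    refine mem_dualOrbit.2 ⟨r • a, fun b => ?_⟩
    simp [ha]

/-- The finite dual as a submodule of the module `R^A` of all maps from `A` to `R`. -/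
def finiteDualFun (R A : Type*) [CommRing R] [IsNoetherianRing R] [Ring A] [Algebra R A] :
    Submodule R (A → R) :=
  (finiteDual R A).map (LinearMap.ltoFun R A R R)

/-- Let `e : X → A^*` be a linear map, where `X` is a coalgebra (in use, `X = A°` and `e` is the
inclusion). The coalgebra structure of `X` is dual to the algebra structure of `A` if
`ε(x) = e(x)(1)` and `e(x)(a b) = ∑ e(x₁)(a) e(x₂)(b)` for `Δ(x) = ∑ x₁ ⊗ x₂`. -/
structure IsDualCoalgebra {R X A : Type*} [CommRing R] [AddCommMonoid X] [Module R X]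
    [Coalgebra R X] [Ring A] [Algebra R A] (e : X →ₗ[R] A →ₗ[R] R) : Prop where
  counit_eq : ∀ x : X, Coalgebra.counit (R := R) x = e x 1
  comul_eq : ∀ (x : X) (a b : A),
    TensorProduct.dualDistrib R A A (TensorProduct.map e e (Coalgebra.comul (R := R) x))
      (a ⊗ₜ[R] b) = e x (a * b)

/-- Let `H` be a bialgebra, with convolution algebra `H^*`, and `i : X → H^*` an injective map
(in use, the inclusion of `X = H°`). A bialgebra structure on `X` is the dual one if `i` is an
algebra morphism for it (so that all module and algebra operations of `X` are those of `H^*`), and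
its coalgebra structure is dual to the algebra structure of `H`. -/
def IsDualBialgebra {R X H : Type*} [CommRing R] [Ring X] [Bialgebra R X] [Ring H] [Bialgebra R H]
    (i : X → H →ₗ[R] R) : Prop :=
  ∃ e : X →ₐ[R] WithConv (H →ₗ[R] R), (∀ x, (e x).ofConv = i x) ∧
    IsDualCoalgebra ((WithConv.linearEquiv R (H →ₗ[R] R)).toLinearMap ∘ₗ e.toLinearMap)

universe w u v v' t

/-! Over a noetherian ring `M ⊗ R^A → M^A` is injective, so purity of `A°` in `R^A` makes `(A°, A)`
a rational system (`isRationalSystem_finiteDual`). Rational systems are stable under tensor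
products, so elements of `X ⊗ X` and `X ⊗ X ⊗ X` are determined by their values on pure tensors from
`A`. Hence `Δ` is unique, and the coalgebra, bialgebra and Hopf axioms for `A°` are transposes of
identities in `A`.

For the existence of `Δ(f)`, finite generation of `f A` gives `f(ab) = ∑ cᵢ(a) gᵢ(b)` with `gᵢ ∈
A°`, the `cᵢ` being mere functions. As `a ↦ f(ab)` is in `A°` for every `b`, rationality shows that
`∑ cᵢ ⊗ gᵢ` dies in `(R^A / A°) ⊗ A°`, so it comes from `A° ⊗ A°`
(`IsRationalSystem.exists_tensorPairing_eq`).

A rational pairing is a rational system whose coalgebra structure is dual to `A`. Rationality passes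
to pure submodules, and conversely a map `j` into `A°` whose pairing is rational has pure image;
this relates rational pairings to subcoalgebras. -/

/-! ### Rational systems: reduction of universes, purity, tensor products. -/

section RationalSystems

variable {R : Type u} [CommRing R]
variable {P Q S A B C M N : Type*} [AddCommGroup P] [Module R P] [AddCommGroup Q] [Module R Q]
  [AddCommGroup S] [Module R S] [AddCommGroup A] [Module R A] [AddCommGroup B] [Module R B]
  [AddCommGroup C] [Module R C] [AddCommGroup M] [Module R M] [AddCommGroup N] [Module R N]

/-- Over a noetherian ring, `M ⊗ R^ι → M^ι` is injective for every set `ι`. -/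
theorem piScalarRightHom_injective [IsNoetherianRing R] (M : Type*) [AddCommGroup M] [Module R M]
    (ι : Type*) : Function.Injective (TensorProduct.piScalarRightHom R R M ι) := by
  rw [injective_iff_map_eq_zero]
  intro z hz
  obtain ⟨k, m, f, rfl⟩ := TensorProduct.exists_sum_tmul_eq z
  -- The relations among the `m j` are finitely generated, and each `(f j i)_j` is one of them;
  -- expanding in the generators `g` rewrites `z` as a sum of terms `(∑ j, g l j • m j) ⊗ c l = 0`.
  obtain ⟨s, g, hg⟩ := Submodule.fg_iff_exists_fin_generating_family.1
    (IsNoetherian.noetherian (LinearMap.ker (Fintype.linearCombination R m)))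
  have hmem (i : ι) : (fun j => f j i) ∈ Submodule.span R (Set.range g) := by
    rw [hg, LinearMap.mem_ker, Fintype.linearCombination_apply]
    simpa using congrFun hz i
  choose c hc using fun i => (Submodule.mem_span_range_iff_exists_fun R).1 (hmem i)
  have hg0 (l : Fin s) : ∑ j, g l j • m j = 0 := by
    have : g l ∈ LinearMap.ker (Fintype.linearCombination R m) :=
      hg ▸ Submodule.subset_span ⟨l, rfl⟩
    simpa [Fintype.linearCombination_apply] using this
  have hf (j : Fin k) : f j = ∑ l, g l j • fun i => c i l := by
    ext i
    simpa [mul_comm] using (congrFun (hc i) j).symm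
  simp_rw [hf, TensorProduct.tmul_sum, TensorProduct.tmul_smul, TensorProduct.smul_tmul']
  rw [Finset.sum_comm]
  simp_rw [← TensorProduct.sum_tmul, hg0]
  simp

theorem pairingMap_rTensor (β : P →ₗ[R] A →ₗ[R] R) (g : M →ₗ[R] N) (z : M ⊗[R] P) :
    pairingMap β N (g.rTensor P z) = g ∘ₗ pairingMap β M z := by
  induction z with
  | zero => simp
  | tmul m p => ext a; simp [pairingMap_tmul_apply]
  | add x y hx hy => simp [hx, hy, LinearMap.comp_add]

theorem pairingMap_lTensor (β : P →ₗ[R] A →ₗ[R] R) (g : Q →ₗ[R] P) (z : M ⊗[R] Q) :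
    pairingMap β M (g.lTensor M z) = pairingMap (β ∘ₗ g) M z := by
  induction z with
  | zero => simp
  | tmul m p => ext a; simp [pairingMap_tmul_apply]
  | add x y hx hy => simp [hx, hy]

theorem pairingMap_apply_eq_piScalarRightHom (β : P →ₗ[R] A →ₗ[R] R) (z : M ⊗[R] P) (a : A) :
    pairingMap β M z a = TensorProduct.piScalarRightHom R R M A
      ((LinearMap.ltoFun R A R R ∘ₗ β).lTensor M z) a := by
  induction z with
  | zero => simp
  | tmul m p => simp [pairingMap_tmul_apply]
  | add x y hx hy => simp [hx, hy]

/-- It suffices to test rationality on the modules in the universe of the ring. -/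
theorem IsRationalSystem.lift {β : P →ₗ[R] A →ₗ[R] R} (h : IsRationalSystem.{u} β) :
    IsRationalSystem.{w} β := by
  intro M _ _
  rw [injective_iff_map_eq_zero]
  intro z hz
  obtain ⟨M', _, hM'⟩ := TensorProduct.exists_finite_submodule_left_of_setFinite {z}
    (Set.finite_singleton z)
  obtain ⟨z', rfl⟩ := hM' rfl
  -- The quotient `Rⁿ / K` lives in the universe of `R`, so `h` applies to it.
  obtain ⟨n, K, ⟨e⟩⟩ := Module.Finite.exists_fin_quot_equiv R M'
  have h0 : pairingMap β M' z' = 0 := by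
    ext a
    simpa [pairingMap_rTensor] using LinearMap.congr_fun hz a
  have h1 : e.symm.toLinearMap.rTensor P z' = 0 :=
    h _ (by rw [pairingMap_rTensor, h0, map_zero, LinearMap.comp_zero])
  have h2 : z' = 0 := (e.symm.rTensor P).injective (h1.trans (map_zero _).symm)
  rw [h2, map_zero]

theorem IsRationalSystem.injective {β : P →ₗ[R] A →ₗ[R] R} (h : IsRationalSystem.{u} β) :
    Function.Injective β := by
  intro p q hpq
  have : (1 : R) ⊗ₜ[R] p = 1 ⊗ₜ q := h R (by ext a; simp [pairingMap_tmul_apply, hpq])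
  simpa using congrArg (TensorProduct.lid R P) this

/-- `α_M` factors as `M ⊗ P → M ⊗ R^A → M^A`, and the second map is injective. -/
theorem IsRationalSystem.of_lTensor_injective [IsNoetherianRing R] {β : P →ₗ[R] A →ₗ[R] R}
    (h : ∀ (M : Type w) [AddCommGroup M] [Module R M],
      Function.Injective ((LinearMap.ltoFun R A R R ∘ₗ β).lTensor M)) :
    IsRationalSystem.{w} β := by
  intro M _ _ z z' hz
  refine h M (piScalarRightHom_injective M A (funext fun a => ?_))
  rw [← pairingMap_apply_eq_piScalarRightHom, ← pairingMap_apply_eq_piScalarRightHom, hz]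

theorem IsRationalSystem.comp {β : P →ₗ[R] A →ₗ[R] R} (h : IsRationalSystem.{w} β)
    {g : Q →ₗ[R] P} (hg : ∀ (M : Type w) [AddCommGroup M] [Module R M],
      Function.Injective (g.rTensor M)) :
    IsRationalSystem.{w} (β ∘ₗ g) := by
  intro M _ _ z z' hz
  rw [← pairingMap_lTensor, ← pairingMap_lTensor] at hz
  exact LinearMap.lTensor_inj_iff_rTensor_inj M g |>.2 (hg M) (h M hz)

theorem IsRationalSystem.rTensor_injective {β : P →ₗ[R] A →ₗ[R] R} {g : Q →ₗ[R] P}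
    (h : IsRationalSystem.{w} (β ∘ₗ g)) (M : Type w) [AddCommGroup M] [Module R M] :
    Function.Injective (g.rTensor M) := by
  refine LinearMap.lTensor_inj_iff_rTensor_inj M g |>.1 fun z z' hz => h M ?_
  rw [← pairingMap_lTensor, ← pairingMap_lTensor, hz]

theorem isPureSubmodule_range {g : Q →ₗ[R] P}
    (h : ∀ (M : Type w) [AddCommGroup M] [Module R M], Function.Injective (g.rTensor M)) :
    IsPureSubmodule.{w} (LinearMap.range g) := by
  intro X _ _ z z' hz
  have hs := LinearMap.rTensor_surjective X g.surjective_rangeRestrict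
  obtain ⟨y, rfl⟩ := hs z
  obtain ⟨y', rfl⟩ := hs z'
  rw [← LinearMap.comp_apply, ← LinearMap.comp_apply, ← LinearMap.rTensor_comp] at hz
  rw [h X hz]

/-- The pairing `⟨p ⊗ q, a ⊗ b⟩ = ⟨p, a⟩ ⟨q, b⟩`. -/
noncomputable def tensorPairing (β : P →ₗ[R] A →ₗ[R] R) (γ : Q →ₗ[R] B →ₗ[R] R) :
    P ⊗[R] Q →ₗ[R] A ⊗[R] B →ₗ[R] R :=
  TensorProduct.dualDistrib R A B ∘ₗ TensorProduct.map β γ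

@[simp]
theorem tensorPairing_tmul_tmul (β : P →ₗ[R] A →ₗ[R] R) (γ : Q →ₗ[R] B →ₗ[R] R) (p : P) (q : Q)
    (a : A) (b : B) : tensorPairing β γ (p ⊗ₜ q) (a ⊗ₜ b) = β p a * γ q b := rfl

theorem pairingMap_tensorPairing (β : P →ₗ[R] A →ₗ[R] R) (γ : Q →ₗ[R] B →ₗ[R] R)
    (z : (M ⊗[R] P) ⊗[R] Q) (a : A) (b : B) :
    pairingMap (tensorPairing β γ) M (TensorProduct.assoc R M P Q z) (a ⊗ₜ b) =
      pairingMap β M (pairingMap γ (M ⊗[R] P) z b) a := by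
  induction z with
  | zero => simp
  | add x y hx hy => simp [hx, hy]
  | tmul x q =>
    induction x with
    | zero => simp
    | add x y hx hy => simp_all [TensorProduct.add_tmul]
    | tmul m p =>
      simp [pairingMap_tmul_apply, TensorProduct.smul_tmul', mul_smul, smul_comm (β p a)]

theorem IsRationalSystem.tensor {β : P →ₗ[R] A →ₗ[R] R} {γ : Q →ₗ[R] B →ₗ[R] R}
    (hβ : IsRationalSystem.{u} β) (hγ : IsRationalSystem.{u} γ) :
    IsRationalSystem.{u} (tensorPairing β γ) := by
  intro M _ _ z z' hz
  obtain ⟨y, rfl⟩ := (TensorProduct.assoc R M P Q).surjective z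
  obtain ⟨y', rfl⟩ := (TensorProduct.assoc R M P Q).surjective z'
  -- `α_M` of the product pairing is `α_{M ⊗ P}` for `γ` followed by `α_M` for `β`.
  refine congrArg _ (hγ.lift _ (LinearMap.ext fun b => hβ _ (LinearMap.ext fun a => ?_)))
  rw [← pairingMap_tensorPairing, ← pairingMap_tensorPairing, hz]

theorem IsRationalSystem.tensorPairing_ext {β : P →ₗ[R] A →ₗ[R] R} {γ : Q →ₗ[R] B →ₗ[R] R}
    (hβ : IsRationalSystem.{u} β) (hγ : IsRationalSystem.{u} γ) {z z' : P ⊗[R] Q}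
    (h : ∀ a b, tensorPairing β γ z (a ⊗ₜ b) = tensorPairing β γ z' (a ⊗ₜ b)) :
    z = z' :=
  (hβ.tensor hγ).injective (TensorProduct.ext' h)

theorem IsRationalSystem.tensorPairing_ext_threefold {β : P →ₗ[R] A →ₗ[R] R}
    {γ : Q →ₗ[R] B →ₗ[R] R} {δ : S →ₗ[R] C →ₗ[R] R} (hβ : IsRationalSystem.{u} β)
    (hγ : IsRationalSystem.{u} γ) (hδ : IsRationalSystem.{u} δ) {z z' : P ⊗[R] Q ⊗[R] S}
    (h : ∀ a b c, tensorPairing (tensorPairing β γ) δ z (a ⊗ₜ b ⊗ₜ c) =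
      tensorPairing (tensorPairing β γ) δ z' (a ⊗ₜ b ⊗ₜ c)) :
    z = z' :=
  ((hβ.tensor hγ).tensor hδ).injective (TensorProduct.ext_threefold h)

theorem tensorPairing_map_map {P' Q' : Type*} [AddCommGroup P'] [Module R P'] [AddCommGroup Q']
    [Module R Q'] (β : P →ₗ[R] A →ₗ[R] R) (γ : Q →ₗ[R] B →ₗ[R] R) (g : P' →ₗ[R] P)
    (g' : Q' →ₗ[R] Q) (z : P' ⊗[R] Q') :
    tensorPairing β γ (TensorProduct.map g g' z) = tensorPairing (β ∘ₗ g) (γ ∘ₗ g') z := by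
  rw [tensorPairing, tensorPairing, TensorProduct.map_comp]
  rfl

end RationalSystems

/-! ### Coalgebra structures dual to an algebra. -/

section DualCoalgebra

variable {R : Type u} [CommRing R]
variable {X Y A B : Type*} [AddCommGroup X] [Module R X] [AddCommGroup Y] [Module R Y]
  [Ring A] [Algebra R A] [Ring B] [Algebra R B]

theorem IsDualCoalgebra.tensorPairing_comul [Coalgebra R X] {e : X →ₗ[R] A →ₗ[R] R}
    (he : IsDualCoalgebra e) (x : X) (a b : A) :
    tensorPairing e e (Coalgebra.comul (R := R) x) (a ⊗ₜ b) = e x (a * b) :=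
  he.comul_eq x a b

theorem tensorPairing_one_left (e : X →ₗ[R] A →ₗ[R] R) (z : X ⊗[R] X) (a : A) :
    e (TensorProduct.lid R X ((e.flip 1).rTensor X z)) a = tensorPairing e e z (1 ⊗ₜ a) := by
  induction z with
  | zero => simp
  | tmul x y => simp
  | add x y hx hy => simp [hx, hy]

theorem tensorPairing_one_right (e : X →ₗ[R] A →ₗ[R] R) (z : X ⊗[R] X) (a : A) :
    e (TensorProduct.rid R X ((e.flip 1).lTensor X z)) a = tensorPairing e e z (a ⊗ₜ 1) := by
  induction z with
  | zero => simp
  | tmul x y => simp [mul_comm]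
  | add x y hx hy => simp [hx, hy]

theorem tensorPairing_rTensor {e : X →ₗ[R] A →ₗ[R] R} {Δ : X →ₗ[R] X ⊗[R] X}
    (hΔ : ∀ x a b, tensorPairing e e (Δ x) (a ⊗ₜ b) = e x (a * b)) (z : X ⊗[R] X) (a b c : A) :
    tensorPairing (tensorPairing e e) e (Δ.rTensor X z) (a ⊗ₜ b ⊗ₜ c) =
      tensorPairing e e z ((a * b) ⊗ₜ c) := by
  induction z with
  | zero => simp
  | tmul x y => simp [hΔ]
  | add x y hx hy => simp [hx, hy]

theorem tensorPairing_assoc (e : X →ₗ[R] A →ₗ[R] R) (z : X ⊗[R] X ⊗[R] X) (a b c : A) :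
    tensorPairing e (tensorPairing e e) (TensorProduct.assoc R X X X z) (a ⊗ₜ (b ⊗ₜ c)) =
      tensorPairing (tensorPairing e e) e z (a ⊗ₜ b ⊗ₜ c) := by
  induction z with
  | zero => simp
  | add x y hx hy => simp [hx, hy]
  | tmul z x₃ =>
    induction z with
    | zero => simp
    | add x y hx hy => simp_all [TensorProduct.add_tmul]
    | tmul x₁ x₂ => simp [mul_assoc]

theorem tensorPairing_lTensor {e : X →ₗ[R] A →ₗ[R] R} {Δ : X →ₗ[R] X ⊗[R] X}
    (hΔ : ∀ x a b, tensorPairing e e (Δ x) (a ⊗ₜ b) = e x (a * b)) (z : X ⊗[R] X) (a b c : A) :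
    tensorPairing e (tensorPairing e e) (Δ.lTensor X z) (a ⊗ₜ (b ⊗ₜ c)) =
      tensorPairing e e z (a ⊗ₜ (b * c)) := by
  induction z with
  | zero => simp
  | tmul x y => simp [hΔ]
  | add x y hx hy => simp [hx, hy]

theorem IsRationalSystem.coalgebra_ext {e : X →ₗ[R] A →ₗ[R] R} (h : IsRationalSystem.{u} e)
    {c c' : Coalgebra R X} (hc : @IsDualCoalgebra R X A _ _ _ c _ _ e)
    (hc' : @IsDualCoalgebra R X A _ _ _ c' _ _ e) : c = c' := by
  have h₁ : c.comul = c'.comul := LinearMap.ext fun x =>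
    h.tensorPairing_ext h fun a b => (@IsDualCoalgebra.comul_eq R X A _ _ _ c _ _ e hc x a b).trans
      (@IsDualCoalgebra.comul_eq R X A _ _ _ c' _ _ e hc' x a b).symm
  have h₂ : c.counit = c'.counit :=
    LinearMap.ext fun x => (@IsDualCoalgebra.counit_eq R X A _ _ _ c _ _ e hc x).trans
      (@IsDualCoalgebra.counit_eq R X A _ _ _ c' _ _ e hc' x).symm
  obtain @⟨⟨Δ, ε⟩, _, _, _⟩ := c
  obtain @⟨⟨Δ', ε'⟩, _, _, _⟩ := c'
  obtain rfl : Δ = Δ' := h₁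
  obtain rfl : ε = ε' := h₂
  rfl

/-- A rational system between `X` and an algebra `A` determines a dual coalgebra structure on `X`
as soon as every `(a, b) ↦ ⟨x, a b⟩` comes from `X ⊗ X`. -/
theorem IsRationalSystem.existsUnique_coalgebra {e : X →ₗ[R] A →ₗ[R] R}
    (h : IsRationalSystem.{u} e)
    (H : ∀ x, ∃ z : X ⊗[R] X, ∀ a b, tensorPairing e e z (a ⊗ₜ b) = e x (a * b)) :
    ∃! _c : Coalgebra R X, IsDualCoalgebra e := by
  -- The chosen `D x` is the only possible value, which makes `D` linear.
  choose D hD using H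
  let Δ : X →ₗ[R] X ⊗[R] X :=
    { toFun := D
      map_add' := fun x y => h.tensorPairing_ext h fun a b => by simp [hD]
      map_smul' := fun r x => h.tensorPairing_ext h fun a b => by simp [hD] }
  have hΔ (x : X) (a b : A) : tensorPairing e e (Δ x) (a ⊗ₜ b) = e x (a * b) := hD x a b
  let c : Coalgebra R X :=
    { comul := Δ
      counit := e.flip 1
      coassoc := by
        ext x
        apply (TensorProduct.assoc R X X X).symm.injective
        refine h.tensorPairing_ext_threefold h h fun a b c => ?_
        rw [← tensorPairing_assoc, ← tensorPairing_assoc, LinearEquiv.apply_symm_apply]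
        simp [tensorPairing_assoc, tensorPairing_rTensor hΔ, tensorPairing_lTensor hΔ, hΔ,
          mul_assoc]
      rTensor_counit_comp_comul := by
        ext x
        apply (TensorProduct.lid R X).injective
        refine h.injective (LinearMap.ext fun a => ?_)
        simp [tensorPairing_one_left, hΔ]
      lTensor_counit_comp_comul := by
        ext x
        apply (TensorProduct.rid R X).injective
        refine h.injective (LinearMap.ext fun a => ?_)
        simp [tensorPairing_one_right, hΔ] }
  have hc : IsDualCoalgebra e := ⟨fun x => rfl, hD⟩
  exact ⟨c, hc, fun c' hc' => h.coalgebra_ext hc' hc⟩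

/-- A linear map that is compatible with an algebra morphism is a coalgebra morphism for the dual
coalgebra structures. -/
theorem IsDualCoalgebra.exists_coalgHom [Coalgebra R X] [Coalgebra R Y]
    {e : X →ₗ[R] A →ₗ[R] R} {e' : Y →ₗ[R] B →ₗ[R] R} (hX : IsDualCoalgebra e)
    (hY : IsDualCoalgebra e') (h : IsRationalSystem.{u} e) (φ : A →ₐ[R] B) (g : Y →ₗ[R] X)
    (hg : ∀ y a, e (g y) a = e' y (φ a)) : ∃ ψ : Y →ₗc[R] X, ∀ y, ψ y = g y := by
  have key (z : Y ⊗[R] Y) (a b : A) : tensorPairing e e (TensorProduct.map g g z) (a ⊗ₜ b) =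
      tensorPairing e' e' z (φ a ⊗ₜ φ b) := by
    induction z with
    | zero => simp
    | tmul x y => simp [hg]
    | add x y hx hy => simp [hx, hy]
  refine ⟨{ g with counit_comp := ?_, map_comp_comul := ?_ }, fun y => rfl⟩
  · ext y
    simp [hX.counit_eq, hY.counit_eq, hg]
  · ext y
    refine h.tensorPairing_ext h fun a b => ?_
    simp [key, hX.tensorPairing_comul, hY.tensorPairing_comul, hg]

theorem IsDualCoalgebra.comp_coalgHom [Coalgebra R X] [Coalgebra R Y]
    {e : X →ₗ[R] A →ₗ[R] R} (h : IsDualCoalgebra e) (ι : Y →ₗc[R] X) :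
    IsDualCoalgebra (e ∘ₗ ι.toLinearMap) where
  counit_eq y := by simp [← h.counit_eq]
  comul_eq y a b := by
    change tensorPairing _ _ _ _ = _
    rw [← tensorPairing_map_map]
    simp [← h.tensorPairing_comul]

/-- Unit and product of `C^*` are `ε` and the transpose of `Δ`, so both sides express the same two
identities. -/
theorem isDualCoalgebra_iff_exists_algHom [Coalgebra R X] (e : X →ₗ[R] A →ₗ[R] R) :
    IsDualCoalgebra e ↔ ∃ φ : A →ₐ[R] WithConv (X →ₗ[R] R), ∀ a x, φ a x = e x a := by
  have key (φ : A → WithConv (X →ₗ[R] R)) (hφ : ∀ a x, φ a x = e x a) (a b : A) (x : X) :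
      (φ a * φ b) x = tensorPairing e e (Coalgebra.comul (R := R) x) (a ⊗ₜ b) := by
    rw [LinearMap.convMul_apply]
    induction Coalgebra.comul (R := R) x with
    | zero => simp
    | tmul x y => simp [hφ]
    | add x y hx hy => simp [hx, hy]
  constructor
  · intro h
    let ψ : A →ₗ[R] WithConv (X →ₗ[R] R) :=
      (WithConv.linearEquiv R (X →ₗ[R] R)).symm.toLinearMap ∘ₗ e.flip
    have hψ (a : A) (x : X) : ψ a x = e x a := rfl
    refine ⟨AlgHom.ofLinearMap ψ ?_ ?_, fun a x => rfl⟩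
    · ext x
      simp [hψ, h.counit_eq]
    · intro a b
      ext x
      rw [key ψ hψ, h.tensorPairing_comul, hψ]
  · rintro ⟨φ, hφ⟩
    refine ⟨fun x => ?_, fun x a b => ?_⟩
    · rw [← hφ, map_one]
      simp
    · change tensorPairing _ _ _ _ = _
      rw [← key φ hφ, ← map_mul, hφ]

end DualCoalgebra

/-! ### The finite dual and its comultiplication. -/

section FiniteDual

variable {R : Type u} [CommRing R] [IsNoetherianRing R]
variable {A B : Type*} [Ring A] [Algebra R A] [Ring B] [Algebra R B]

theorem mem_finiteDual_of_le {f : A →ₗ[R] R} {N : Submodule R (A →ₗ[R] R)} (hN : N.FG)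
    (h : ∀ a, f ∘ₗ LinearMap.mulRight R a ∈ N) : f ∈ finiteDual R A := by
  have := isNoetherian_of_fg_of_noetherian N hN
  refine isNoetherian_submodule.1 this _ fun g hg => ?_
  obtain ⟨a, ha⟩ := mem_dualOrbit.1 hg
  rw [show g = f ∘ₗ LinearMap.mulRight R a from LinearMap.ext ha]
  exact h a

omit [IsNoetherianRing R] in
theorem comp_mulRight_mem_dualOrbit (f : A →ₗ[R] R) (a : A) :
    f ∘ₗ LinearMap.mulRight R a ∈ dualOrbit R f := ⟨a, rfl⟩

theorem comp_mulRight_mem_finiteDual {f : A →ₗ[R] R} (hf : f ∈ finiteDual R A) (a : A) :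
    f ∘ₗ LinearMap.mulRight R a ∈ finiteDual R A :=
  mem_finiteDual_of_le hf fun b => mem_dualOrbit.2 ⟨b * a, fun c => by simp [mul_assoc]⟩

theorem comp_mulLeft_mem_finiteDual {f : A →ₗ[R] R} (hf : f ∈ finiteDual R A) (a : A) :
    f ∘ₗ LinearMap.mulLeft R a ∈ finiteDual R A :=
  mem_finiteDual_of_le (Submodule.FG.map (LinearMap.lcomp R R (LinearMap.mulLeft R a)) hf)
    fun b => ⟨_, comp_mulRight_mem_dualOrbit f b, LinearMap.ext fun c => by simp [mul_assoc]⟩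

theorem comp_algHom_mem_finiteDual (φ : A →ₐ[R] B) {f : B →ₗ[R] R} (hf : f ∈ finiteDual R B) :
    f ∘ₗ φ.toLinearMap ∈ finiteDual R A :=
  mem_finiteDual_of_le (Submodule.FG.map (LinearMap.lcomp R R φ.toLinearMap) hf)
    fun a => ⟨_, comp_mulRight_mem_dualOrbit f (φ a), LinearMap.ext fun c => by simp⟩

/-- For `f ∈ A°`, the submodule `f A` of `A^*`, where `(f a)(b) = f (a b)`, is finitely
generated. -/
theorem fg_range_comp_mulLeft {f : A →ₗ[R] R} (hf : f ∈ finiteDual R A) :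
    (LinearMap.range ((LinearMap.mul R A).compr₂ f)).FG := by
  have hfin : Module.Finite R (dualOrbit R f) := Module.Finite.iff_fg.2 hf
  -- Since `f(ab) = (bf)(a)`, the form `f a` is evaluation at `a` on `A f`, pulled back along `g : b
  -- ↦ bf`. Thus `f A` lies in the image of the finitely generated dual of `A f`.
  let g : A →ₗ[R] dualOrbit R f := ((LinearMap.mul R A).flip.compr₂ f).rangeRestrict
  have hN : (LinearMap.range (LinearMap.lcomp R R g)).FG := by
    rw [LinearMap.range_eq_map]
    exact Submodule.FG.map _ ((isNoetherian_linearMap R R (dualOrbit R f)).noetherian ⊤)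
  have := isNoetherian_of_fg_of_noetherian _ hN
  refine isNoetherian_submodule.1 this _ ?_
  rintro _ ⟨a, rfl⟩
  exact ⟨(LinearMap.applyₗ a) ∘ₗ (dualOrbit R f).subtype, rfl⟩

omit [IsNoetherianRing R] in
/-- A finite sum `∑ dᵢ(a) ⟨xᵢ, b⟩` whose restrictions to the lines `b = const` lie in `X` comes from
`X ⊗ X`. -/
theorem IsRationalSystem.exists_tensorPairing_eq {X : Type*} [AddCommGroup X] [Module R X]
    {e : X →ₗ[R] A →ₗ[R] R} (h : IsRationalSystem.{u} e) {n : ℕ} (d : Fin n → A → R)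
    (x : Fin n → X) (H : ∀ b, ∃ y, ∀ a, ∑ i, d i a * e (x i) b = e y a) :
    ∃ z : X ⊗[R] X, ∀ a b, tensorPairing e e z (a ⊗ₜ b) = ∑ i, d i a * e (x i) b := by
  let ι : X →ₗ[R] A → R := LinearMap.ltoFun R A R R ∘ₗ e
  let q := (LinearMap.range ι).mkQ
  let s : (A → R) ⊗[R] X := ∑ i, d i ⊗ₜ x i
  -- Rationality with coefficients in `R^A / X`: pairing with `b` gives the class of a function that
  -- `H` places in `X`.
  have hs : q.rTensor X s = 0 := by
    refine h.lift _ (LinearMap.ext fun b => ?_)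
    obtain ⟨y, hy⟩ := H b
    rw [pairingMap_rTensor, map_zero]
    simp only [s, map_sum, LinearMap.comp_apply, LinearMap.sum_apply, pairingMap_tmul_apply,
      LinearMap.zero_apply]
    rw [← map_sum, Submodule.mkQ_apply, Submodule.Quotient.mk_eq_zero]
    exact ⟨y, funext fun a => by simp [ι, ← hy, mul_comm]⟩
  have hex : Function.Exact ι q := LinearMap.exact_iff.2 (Submodule.ker_mkQ _)
  obtain ⟨z, hz⟩ := (rTensor_exact X hex (Submodule.mkQ_surjective _) s).1 hs
  refine ⟨z, fun a b => ?_⟩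
  have key (z : X ⊗[R] X) : tensorPairing e e z (a ⊗ₜ b) =
      pairingMap e (A → R) (ι.rTensor X z) b a := by
    induction z with
    | zero => simp
    | tmul x y => simp [pairingMap_tmul_apply, ι, mul_comm]
    | add x y hx hy => simp [hx, hy]
  simp [key, hz, s, pairingMap_tmul_apply, mul_comm]

theorem isRationalSystem_finiteDual (hA : IsPureSubmodule.{u} (finiteDualFun R A)) :
    IsRationalSystem.{u} (finiteDual R A).subtype := by
  refine IsRationalSystem.of_lTensor_injective (P := finiteDual R A) fun M _ _ => ?_
  let ε : finiteDual R A ≃ₗ[R] finiteDualFun R A :=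
    Submodule.equivMapOfInjective (LinearMap.ltoFun R A R R)
      DFunLike.coe_injective (finiteDual R A)
  have : LinearMap.ltoFun R A R R ∘ₗ (finiteDual R A).subtype =
      (finiteDualFun R A).subtype ∘ₗ ε.toLinearMap := rfl
  rw [this, LinearMap.lTensor_comp]
  exact (LinearMap.lTensor_inj_iff_rTensor_inj M _ |>.2 (hA M)).comp (ε.lTensor M).injective

theorem existsUnique_coalgebra_finiteDual (hA : IsPureSubmodule.{u} (finiteDualFun R A)) :
    ∃! _c : Coalgebra R (finiteDual R A), IsDualCoalgebra (finiteDual R A).subtype := by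
  have h := isRationalSystem_finiteDual hA
  refine IsRationalSystem.existsUnique_coalgebra (X := finiteDual R A) h fun ⟨f, hf⟩ => ?_
  obtain ⟨n, g, hg⟩ := Submodule.fg_iff_exists_fin_generating_family.1 (fg_range_comp_mulLeft hf)
  have hgf (i : Fin n) : g i ∈ finiteDual R A := by
    obtain ⟨a, ha⟩ : g i ∈ LinearMap.range ((LinearMap.mul R A).compr₂ f) :=
      hg ▸ Submodule.subset_span ⟨i, rfl⟩
    rw [← ha]
    exact comp_mulLeft_mem_finiteDual hf a
  have hmem (a : A) : (LinearMap.mul R A).compr₂ f a ∈ Submodule.span R (Set.range g) :=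
    hg ▸ LinearMap.mem_range_self _ a
  -- The coefficients are chosen pointwise and need not be linear in `a`, hence the ambient module
  -- `R^A`.
  choose c hc using fun a => (Submodule.mem_span_range_iff_exists_fun R).1 (hmem a)
  have hsum (a b : A) : ∑ i, c a i * g i b = f (a * b) := by
    simpa using LinearMap.congr_fun (hc a) b
  obtain ⟨z, hz⟩ := IsRationalSystem.exists_tensorPairing_eq (X := finiteDual R A) h
    (fun i a => c a i) (fun i => ⟨g i, hgf i⟩)
    fun b => ⟨⟨_, comp_mulRight_mem_finiteDual hf b⟩, fun a => hsum a b⟩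
  exact ⟨z, fun a b => (hz a b).trans (hsum a b)⟩

end FiniteDual

/-! ### Subcoalgebras and restricted pairings. -/

section Subcoalgebra

variable {R : Type u} [CommRing R]
variable {X A : Type*} [AddCommGroup X] [Module R X] [Coalgebra R X] [Ring A] [Algebra R A]
  {e : X →ₗ[R] A →ₗ[R] R}

omit [Coalgebra R X] in
theorem IsRationalSystem.comp_subtype (h : IsRationalSystem.{u} e) {D : Submodule R X}
    (hD : IsPureSubmodule.{u} D) : IsRationalSystem.{u} (e ∘ₗ D.subtype) :=
  h.comp hD

/-- Turns questions about coalgebra structures on `D` into ones about structures dual to `A`, which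
rationality settles. -/
theorem exists_coalgHom_iff_isDualCoalgebra (h : IsRationalSystem.{u} e) (he : IsDualCoalgebra e)
    (D : Submodule R X) [Coalgebra R D] :
    (∃ ι : D →ₗc[R] X, ∀ x, ι x = x) ↔ IsDualCoalgebra (e ∘ₗ D.subtype) := by
  constructor
  · rintro ⟨ι, hι⟩
    rw [show D.subtype = ι.toLinearMap from LinearMap.ext fun x => (hι x).symm]
    exact he.comp_coalgHom ι
  · exact fun hD => he.exists_coalgHom hD h (AlgHom.id R A) D.subtype fun y a => rfl

theorem IsSubcoalgebra.existsUnique_coalgebra (h : IsRationalSystem.{u} e)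
    (he : IsDualCoalgebra e) {D : Submodule R X} (hD : IsSubcoalgebra.{u} D) :
    ∃! _c : Coalgebra R D, ∃ ι : D →ₗc[R] X, ∀ x, ι x = x := by
  simp_rw [exists_coalgHom_iff_isDualCoalgebra h he]
  refine (h.comp_subtype hD.pure).existsUnique_coalgebra fun x => ?_
  obtain ⟨z, hz⟩ := hD.comul_mem x x.2
  refine ⟨z, fun a b => ?_⟩
  rw [← tensorPairing_map_map, hz, he.tensorPairing_comul]
  rfl

theorem IsRationalSystem.isSubcoalgebra_range {C : Type*} [AddCommGroup C] [Module R C]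
    [Coalgebra R C] {j : C →ₗc[R] X} (h : IsRationalSystem.{w} (e ∘ₗ j.toLinearMap)) :
    IsSubcoalgebra.{w} (LinearMap.range j.toLinearMap) where
  pure := isPureSubmodule_range h.rTensor_injective
  comul_mem := by
    rintro _ ⟨c, rfl⟩
    let r := j.toLinearMap.rangeRestrict
    refine ⟨TensorProduct.map r r (Coalgebra.comul (R := R) c), ?_⟩
    rw [← LinearMap.comp_apply, ← TensorProduct.map_comp]
    exact CoalgHomClass.map_comp_comul_apply j c

end Subcoalgebra

/-! ### Bialgebra and Hopf axioms by transposition. -/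

section DualBialgebra

variable {R : Type u} [CommRing R]
variable {X H : Type*} [Ring X] [Algebra R X] [Ring H]

/-- The bilinear form of an algebra morphism to a convolution algebra. -/
noncomputable def convPairing [Bialgebra R H] (e : X →ₐ[R] WithConv (H →ₗ[R] R)) :
    X →ₗ[R] H →ₗ[R] R :=
  (WithConv.linearEquiv R (H →ₗ[R] R)).toLinearMap ∘ₗ e.toLinearMap

open Coalgebra in
theorem convPairing_mul [Bialgebra R H] (e : X →ₐ[R] WithConv (H →ₗ[R] R)) (x y : X) {ι : Type*}
    {a : H} (r : Coalgebra.Repr R a ι) :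
    convPairing e (x * y) a =
      ∑ i ∈ r.index, convPairing e x (r.left i) * convPairing e y (r.right i) := by
  change e (x * y) a = _
  rw [map_mul, r.convMul_apply]
  rfl

theorem convPairing_one [Bialgebra R H] (e : X →ₐ[R] WithConv (H →ₗ[R] R)) (a : H) :
    convPairing e 1 a = Coalgebra.counit (R := R) a := by
  change e 1 a = _
  rw [map_one]
  rfl

theorem convPairing_algebraMap [Bialgebra R H] (e : X →ₐ[R] WithConv (H →ₗ[R] R)) (r : R) (a : H) :
    convPairing e (algebraMap R X r) a = r * Coalgebra.counit (R := R) a := by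
  rw [Algebra.algebraMap_eq_smul_one, map_smul, LinearMap.smul_apply, convPairing_one, smul_eq_mul]

theorem tensorPairing_convPairing_mul [Bialgebra R H] (e : X →ₐ[R] WithConv (H →ₗ[R] R))
    (s t : X ⊗[R] X) {ι κ : Type*} {a b : H} (r : Coalgebra.Repr R a ι)
    (r' : Coalgebra.Repr R b κ) :
    tensorPairing (convPairing e) (convPairing e) (s * t) (a ⊗ₜ b) =
      ∑ i ∈ r.index, ∑ j ∈ r'.index,
        tensorPairing (convPairing e) (convPairing e) s (r.left i ⊗ₜ r'.left j) *
        tensorPairing (convPairing e) (convPairing e) t (r.right i ⊗ₜ r'.right j) := by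
  induction s with
  | zero => simp
  | add s s' hs hs' => simp [add_mul, hs, hs', Finset.sum_add_distrib]
  | tmul x y =>
    induction t with
    | zero => simp
    | add t t' ht ht' => simp [mul_add, ht, ht', Finset.sum_add_distrib]
    | tmul x' y' =>
      rw [Algebra.TensorProduct.tmul_mul_tmul, tensorPairing_tmul_tmul, convPairing_mul e _ _ r,
        convPairing_mul e _ _ r', Finset.sum_mul_sum]
      simp [mul_mul_mul_comm]

open Coalgebra in
/-- A coalgebra structure dual to a bialgebra is compatible with the convolution product. -/
noncomputable abbrev IsDualCoalgebra.toBialgebra [Bialgebra R H] [Coalgebra R X]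
    {e : X →ₐ[R] WithConv (H →ₗ[R] R)}
    (hd : IsDualCoalgebra (convPairing e)) (h : IsRationalSystem.{u} (convPairing e)) :
    Bialgebra R X :=
  Bialgebra.mk' R X
    (by rw [hd.counit_eq, convPairing_one, Bialgebra.counit_one])
    (by
      intro x y
      rw [hd.counit_eq, hd.counit_eq, hd.counit_eq]
      change e (x * y) 1 = _
      rw [map_mul, LinearMap.convMul_apply, Bialgebra.comul_one, Algebra.TensorProduct.one_def]
      rfl)
    (h.tensorPairing_ext h fun a b => by
      rw [hd.tensorPairing_comul, Algebra.TensorProduct.one_def, tensorPairing_tmul_tmul]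
      simp_rw [convPairing_one, Bialgebra.counit_mul])
    (by
      intro x y
      refine h.tensorPairing_ext h fun a b => ?_
      -- Both sides become the same double sum because `Δ(ab) = Δ(a)Δ(b)` in `H`.
      rw [hd.tensorPairing_comul, tensorPairing_convPairing_mul e _ _ (ℛ R a) (ℛ R b),
        convPairing_mul e x y ((ℛ R a).mul (ℛ R b))]
      simp_rw [hd.tensorPairing_comul]
      exact Finset.sum_product _ _ _)

section Antipode

variable [HopfAlgebra R H] {e : X →ₐ[R] WithConv (H →ₗ[R] R)} {S : X →ₗ[R] X}

theorem convPairing_mul'_rTensor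
    (hS : ∀ x a, convPairing e (S x) a = convPairing e x (HopfAlgebra.antipode R a)) (s : X ⊗[R] X)
    {ι : Type*} {a : H} (r : Coalgebra.Repr R a ι) :
    convPairing e (LinearMap.mul' R X (S.rTensor X s)) a = ∑ i ∈ r.index,
      tensorPairing (convPairing e) (convPairing e) s
        (HopfAlgebra.antipode R (r.left i) ⊗ₜ r.right i) := by
  induction s with
  | zero => simp
  | add s t hs ht => simp [hs, ht, Finset.sum_add_distrib]
  | tmul x y => simp [convPairing_mul e _ _ r, hS]

theorem convPairing_mul'_lTensor
    (hS : ∀ x a, convPairing e (S x) a = convPairing e x (HopfAlgebra.antipode R a)) (s : X ⊗[R] X)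
    {ι : Type*} {a : H} (r : Coalgebra.Repr R a ι) :
    convPairing e (LinearMap.mul' R X (S.lTensor X s)) a = ∑ i ∈ r.index,
      tensorPairing (convPairing e) (convPairing e) s
        (r.left i ⊗ₜ HopfAlgebra.antipode R (r.right i)) := by
  induction s with
  | zero => simp
  | add s t hs ht => simp [hs, ht, Finset.sum_add_distrib]
  | tmul x y => simp [convPairing_mul e _ _ r, hS]

end Antipode

open Coalgebra in
/-- The transpose of the antipode is an antipode for a dual bialgebra. -/
noncomputable abbrev IsDualCoalgebra.toHopfAlgebra [HopfAlgebra R H] [Coalgebra R X]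
    {e : X →ₐ[R] WithConv (H →ₗ[R] R)}
    (hd : IsDualCoalgebra (convPairing e)) (h : IsRationalSystem.{u} (convPairing e))
    (S : X →ₗ[R] X)
    (hS : ∀ x a, convPairing e (S x) a = convPairing e x (HopfAlgebra.antipode R a)) :
    HopfAlgebra R X where
  toBialgebra := hd.toBialgebra h
  antipode := S
  mul_antipode_rTensor_comul := by
    ext x
    refine h.injective (LinearMap.ext fun a => ?_)
    rw [LinearMap.comp_apply, LinearMap.comp_apply, convPairing_mul'_rTensor hS _ (ℛ R a)]
    simp_rw [hd.tensorPairing_comul]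
    rw [← map_sum, HopfAlgebra.sum_antipode_mul_eq_smul, map_smul, ← hd.counit_eq,
      LinearMap.comp_apply, Algebra.linearMap_apply, convPairing_algebraMap, smul_eq_mul, mul_comm]
  mul_antipode_lTensor_comul := by
    ext x
    refine h.injective (LinearMap.ext fun a => ?_)
    rw [LinearMap.comp_apply, LinearMap.comp_apply, convPairing_mul'_lTensor hS _ (ℛ R a)]
    simp_rw [hd.tensorPairing_comul]
    rw [← map_sum, HopfAlgebra.sum_mul_antipode_eq_smul, map_smul, ← hd.counit_eq,
      LinearMap.comp_apply, Algebra.linearMap_apply, convPairing_algebraMap, smul_eq_mul, mul_comm]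

end DualBialgebra

/-! ### Closure of the finite dual under convolution and the transposed antipode. -/

section FiniteDualBialgebra

variable {R : Type u} [CommRing R] [IsNoetherianRing R]
variable {H : Type*} [Ring H]

theorem counit_mem_finiteDual [Bialgebra R H] :
    Coalgebra.counit (R := R) (A := H) ∈ finiteDual R H :=
  mem_finiteDual_of_le (Submodule.fg_span_singleton (Coalgebra.counit (R := R) (A := H))) fun a =>
    Submodule.mem_span_singleton.2 ⟨Coalgebra.counit (R := R) a,
      LinearMap.ext fun b => by simp [mul_comm]⟩

-- `Δ(ba) = Δ(b)Δ(a)` gives `a(f * g) = ∑ (a₁f) * (a₂g)`, which lies in the finitely generated `(Af)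
-- * (Ag)`.
open Coalgebra in
theorem convMul_mem_finiteDual [Bialgebra R H] {f g : WithConv (H →ₗ[R] R)}
    (hf : f.ofConv ∈ finiteDual R H) (hg : g.ofConv ∈ finiteDual R H) :
    (f * g).ofConv ∈ finiteDual R H := by
  let ε := WithConv.linearEquiv R (H →ₗ[R] R)
  have hfg : (((dualOrbit R f.ofConv).map ε.symm.toLinearMap *
      (dualOrbit R g.ofConv).map ε.symm.toLinearMap).map ε.toLinearMap).FG :=
    Submodule.FG.map ε.toLinearMap (Submodule.FG.mul
      (Submodule.FG.map ε.symm.toLinearMap hf) (Submodule.FG.map ε.symm.toLinearMap hg))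
  refine mem_finiteDual_of_le hfg fun a => ?_
  have hsum : (f * g).ofConv ∘ₗ LinearMap.mulRight R a = ε (∑ i ∈ (ℛ R a).index,
      ε.symm (f.ofConv ∘ₗ LinearMap.mulRight R ((ℛ R a).left i)) *
        ε.symm (g.ofConv ∘ₗ LinearMap.mulRight R ((ℛ R a).right i))) := by
    ext b
    rw [map_sum, LinearMap.sum_apply, LinearMap.comp_apply, LinearMap.mulRight_apply]
    refine (((ℛ R b).mul (ℛ R a)).convMul_apply f g).trans ?_
    refine (Finset.sum_product_right _ _ _).trans (Finset.sum_congr rfl fun i _ => ?_)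
    exact ((ℛ R b).convMul_apply (ε.symm (f.ofConv ∘ₗ LinearMap.mulRight R ((ℛ R a).left i)))
      (ε.symm (g.ofConv ∘ₗ LinearMap.mulRight R ((ℛ R a).right i)))).symm
  rw [hsum]
  refine Submodule.mem_map_of_mem (Submodule.sum_mem _ fun i _ => Submodule.mul_mem_mul ?_ ?_)
  · exact Submodule.mem_map_of_mem (comp_mulRight_mem_dualOrbit _ _)
  · exact Submodule.mem_map_of_mem (comp_mulRight_mem_dualOrbit _ _)

/-- `S` reverses products, so `a(f ∘ S) = (f S(a)) ∘ S`: finiteness of the right orbit `f A` is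
needed. -/
theorem comp_antipode_mem_finiteDual [HopfAlgebra R H] {f : H →ₗ[R] R}
    (hf : f ∈ finiteDual R H) : f ∘ₗ HopfAlgebra.antipode R ∈ finiteDual R H :=
  mem_finiteDual_of_le
    (Submodule.FG.map (LinearMap.lcomp R R (HopfAlgebra.antipode R)) (fg_range_comp_mulLeft hf))
    fun a => ⟨_, LinearMap.mem_range_self _ (HopfAlgebra.antipode R a),
      LinearMap.ext fun b => by simp [HopfAlgebra.antipode_mul_antidistrib]⟩

variable (R H)

/-- The convolution ring structure of the finite dual of a bialgebra. -/
noncomputable abbrev finiteDualRing [Bialgebra R H] : Ring (finiteDual R H) :=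
  { (inferInstance : AddCommGroup (finiteDual R H)) with
    mul := fun f g => ⟨(WithConv.toConv f.1 * WithConv.toConv g.1).ofConv,
      convMul_mem_finiteDual f.2 g.2⟩
    one := ⟨Coalgebra.counit, counit_mem_finiteDual⟩
    mul_assoc := fun f g h => Subtype.ext <| congrArg WithConv.ofConv
      (mul_assoc (WithConv.toConv f.1) (WithConv.toConv g.1) (WithConv.toConv h.1))
    one_mul := fun f => Subtype.ext <| congrArg WithConv.ofConv (one_mul (WithConv.toConv f.1))
    mul_one := fun f => Subtype.ext <| congrArg WithConv.ofConv (mul_one (WithConv.toConv f.1))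
    zero_mul := fun f => Subtype.ext <| congrArg WithConv.ofConv (zero_mul (WithConv.toConv f.1))
    mul_zero := fun f => Subtype.ext <| congrArg WithConv.ofConv (mul_zero (WithConv.toConv f.1))
    left_distrib := fun f g h => Subtype.ext <| congrArg WithConv.ofConv
      (mul_add (WithConv.toConv f.1) (WithConv.toConv g.1) (WithConv.toConv h.1))
    right_distrib := fun f g h => Subtype.ext <| congrArg WithConv.ofConv
      (add_mul (WithConv.toConv f.1) (WithConv.toConv g.1) (WithConv.toConv h.1)) }

/-- The convolution algebra structure of the finite dual of a bialgebra. -/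
noncomputable abbrev finiteDualAlgebra [Bialgebra R H] :
    letI := finiteDualRing R H
    Algebra R (finiteDual R H) :=
  letI := finiteDualRing R H
  letI : Module R (finiteDual R H) := (finiteDual R H).module
  Algebra.ofModule
    (fun r f g => Subtype.ext <| congrArg WithConv.ofConv
      (smul_mul_assoc r (WithConv.toConv f.1) (WithConv.toConv g.1)))
    (fun r f g => Subtype.ext <| congrArg WithConv.ofConv
      (mul_smul_comm r (WithConv.toConv f.1) (WithConv.toConv g.1)))

/-- The inclusion of the finite dual of a bialgebra in the convolution algebra. -/
noncomputable def finiteDualInclusion [Bialgebra R H] :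
    letI := finiteDualRing R H
    letI := finiteDualAlgebra R H
    finiteDual R H →ₐ[R] WithConv (H →ₗ[R] R) :=
  letI := finiteDualRing R H
  letI := finiteDualAlgebra R H
  AlgHom.ofLinearMap
    ((WithConv.linearEquiv R (H →ₗ[R] R)).symm.toLinearMap ∘ₗ (finiteDual R H).subtype) rfl
    fun _ _ => rfl

variable {R H}

theorem exists_bialgebra_finiteDual [Bialgebra R H]
    (hH : IsPureSubmodule.{u} (finiteDualFun R H)) :
    ∃ (_r : Ring (finiteDual R H)) (_b : Bialgebra R (finiteDual R H)),
      IsDualBialgebra (fun f : finiteDual R H => f.1) := by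
  obtain ⟨c, hc, -⟩ := existsUnique_coalgebra_finiteDual hH
  have h := isRationalSystem_finiteDual hH
  let := finiteDualRing R H
  let := finiteDualAlgebra R H
  let : Coalgebra R (finiteDual R H) := c
  -- The form of the inclusion is definitionally the subtype map.
  have hd : IsDualCoalgebra (convPairing (finiteDualInclusion R H)) := hc
  exact ⟨_, hd.toBialgebra h, finiteDualInclusion R H, fun f => rfl, hd⟩

theorem exists_hopfAlgebra_finiteDual [HopfAlgebra R H]
    (hH : IsPureSubmodule.{u} (finiteDualFun R H)) :
    ∃ (_r : Ring (finiteDual R H)) (_b : HopfAlgebra R (finiteDual R H)),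
      IsDualBialgebra (fun f : finiteDual R H => f.1) ∧
      ∀ f : finiteDual R H,
        (HopfAlgebra.antipode R f).1 = f.1 ∘ₗ HopfAlgebra.antipode R := by
  obtain ⟨c, hc, -⟩ := existsUnique_coalgebra_finiteDual hH
  have h := isRationalSystem_finiteDual hH
  let := finiteDualRing R H
  let := finiteDualAlgebra R H
  let : Coalgebra R (finiteDual R H) := c
  have hd : IsDualCoalgebra (convPairing (finiteDualInclusion R H)) := hc
  let S : finiteDual R H →ₗ[R] finiteDual R H :=
    (LinearMap.lcomp R R (HopfAlgebra.antipode R)).restrict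
      fun _ hf => comp_antipode_mem_finiteDual hf
  exact ⟨_, hd.toHopfAlgebra h S fun x a => rfl, ⟨finiteDualInclusion R H, fun f => rfl, hd⟩,
    fun f => rfl⟩

end FiniteDualBialgebra

/-! ### Rational pairings versus subcoalgebras. -/

section RationalPairing

variable {R : Type u} [CommRing R]
variable {X C A : Type*} [AddCommGroup X] [Module R X] [Coalgebra R X] [AddCommGroup C]
  [Module R C] [Coalgebra R C] [Ring A] [Algebra R A]

theorem IsSubcoalgebra.isRationalPairing {e : X →ₗ[R] A →ₗ[R] R} (h : IsRationalSystem.{u} e)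
    (he : IsDualCoalgebra e) {D : Submodule R X} (hD : IsSubcoalgebra.{u} D) [Coalgebra R D]
    (hι : ∃ ι : D →ₗc[R] X, ∀ x, ι x = x) : IsRationalPairing.{w} (e ∘ₗ D.subtype) :=
  ⟨(h.comp_subtype hD.pure).lift, (isDualCoalgebra_iff_exists_algHom _).1
    ((exists_coalgHom_iff_isDualCoalgebra h he D).1 hι)⟩

theorem IsRationalPairing.isDualCoalgebra {β : C →ₗ[R] A →ₗ[R] R}
    (hβ : IsRationalPairing.{w} β) : IsDualCoalgebra β :=
  (isDualCoalgebra_iff_exists_algHom β).2 hβ.algHom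

/-- If `Δ(c) = ∑ xᵢ ⊗ yᵢ`, then `a · β c = ∑ β(yᵢ)(a) β(xᵢ)`, so the `β(xᵢ)` span a module
containing the orbit. -/
theorem IsRationalPairing.mem_finiteDual [IsNoetherianRing R] {β : C →ₗ[R] A →ₗ[R] R}
    (hβ : IsRationalPairing.{w} β) (c : C) : β c ∈ finiteDual R A := by
  obtain ⟨k, x, y, hxy⟩ := TensorProduct.exists_sum_tmul_eq (Coalgebra.comul (R := R) c)
  refine mem_finiteDual_of_le (Submodule.fg_span (Set.finite_range fun i => β (x i)))
    fun a => (Submodule.mem_span_range_iff_exists_fun R).2 ⟨fun i => β (y i) a, ?_⟩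
  ext b
  have hb := hβ.isDualCoalgebra.tensorPairing_comul c b a
  simp only [hxy, map_sum, LinearMap.sum_apply, tensorPairing_tmul_tmul] at hb
  simp [← hb, mul_comm]

/-- As `e ∘ j = β` is rational, `j` stays injective after every tensor product, whence injectivity
and purity of the image. -/
theorem IsRationalPairing.exists_coalgHom {e : X →ₗ[R] A →ₗ[R] R} (h : IsRationalSystem.{u} e)
    (he : IsDualCoalgebra e) {β : C →ₗ[R] A →ₗ[R] R} (hβ : IsRationalPairing.{u} β)
    (g : C →ₗ[R] X) (hg : ∀ c, e (g c) = β c) :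
    ∃ j : C →ₗc[R] X, (∀ c, j c = g c) ∧ Function.Injective j ∧
      IsSubcoalgebra.{w} (LinearMap.range j.toLinearMap) := by
  obtain ⟨j, hj⟩ := he.exists_coalgHom hβ.isDualCoalgebra h (AlgHom.id R A) g
    fun y a => by rw [hg, AlgHom.id_apply]
  have hβj : e ∘ₗ j.toLinearMap = β :=
    LinearMap.ext fun c => (congrArg e (hj c)).trans (hg c)
  have hr : IsRationalSystem.{u} (e ∘ₗ j.toLinearMap) := hβj.symm ▸ hβ.rationalSystem
  exact ⟨j, hj, fun c c' hcc => hr.injective (congrArg e hcc), hr.lift.isSubcoalgebra_range⟩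

end RationalPairing

theorem mainTheorem7 {R : Type u} [CommRing R] [IsNoetherianRing R]
    {A : Type v} [Ring A] [Algebra R A] (hA : IsPureSubmodule.{u} (finiteDualFun R A)) :
    -- `A°` is a coalgebra
    (∃! _c : Coalgebra R (finiteDual R A), IsDualCoalgebra (finiteDual R A).subtype) ∧
    -- if `A` is a bialgebra, then so is `A°`
    (∀ (H : Type v) [Ring H] [Bialgebra R H], IsPureSubmodule.{u} (finiteDualFun R H) →
      ∃ (_r : Ring (finiteDual R H)) (_b : Bialgebra R (finiteDual R H)),
        IsDualBialgebra (fun f : finiteDual R H => f.1)) ∧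
    -- if `A` is a Hopf algebra, then so is `A°`, with antipode `f ↦ f ∘ S`
    (∀ (H : Type v) [Ring H] [HopfAlgebra R H], IsPureSubmodule.{u} (finiteDualFun R H) →
      ∃ (_r : Ring (finiteDual R H)) (_b : HopfAlgebra R (finiteDual R H)),
        IsDualBialgebra (fun f : finiteDual R H => f.1) ∧
        ∀ f : finiteDual R H, (HopfAlgebra.antipode R f).1 = f.1 ∘ₗ HopfAlgebra.antipode R) ∧
    -- algebra morphisms induce coalgebra morphisms between the finite duals
    (∀ (B : Type v') [Ring B] [Algebra R B], IsPureSubmodule.{u} (finiteDualFun R B) →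
      ∀ φ : A →ₐ[R] B,
        (∀ f ∈ finiteDual R B, f ∘ₗ φ.toLinearMap ∈ finiteDual R A) ∧
        ∀ [Coalgebra R (finiteDual R A)] [Coalgebra R (finiteDual R B)],
          IsDualCoalgebra (finiteDual R A).subtype → IsDualCoalgebra (finiteDual R B).subtype →
          ∃ ψ : finiteDual R B →ₗc[R] finiteDual R A,
            ∀ f, (ψ f : A →ₗ[R] R) = (f : B →ₗ[R] R) ∘ₗ φ.toLinearMap) ∧
    -- subcoalgebras of `A°` give rational pairings
    (∀ [Coalgebra R (finiteDual R A)], IsDualCoalgebra (finiteDual R A).subtype →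
      ∀ C : Submodule R (finiteDual R A), IsSubcoalgebra.{u} C →
        (∃! _c : Coalgebra R C, ∃ ι : C →ₗc[R] finiteDual R A, ∀ x, ι x = x) ∧
        ∀ [Coalgebra R C], (∃ ι : C →ₗc[R] finiteDual R A, ∀ x, ι x = x) →
          IsRationalPairing.{w} ((finiteDual R A).subtype ∘ₗ C.subtype)) ∧
    -- rational pairings `(C, A)` make `C` a subcoalgebra of `A°`
    (∀ [Coalgebra R (finiteDual R A)], IsDualCoalgebra (finiteDual R A).subtype →
      ∀ (C : Type t) [AddCommGroup C] [Module R C] [Coalgebra R C] (β : C →ₗ[R] A →ₗ[R] R),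
        IsRationalPairing.{u} β →
        ∃ j : C →ₗc[R] finiteDual R A, (∀ c, (j c : A →ₗ[R] R) = β c) ∧
          Function.Injective j ∧ IsSubcoalgebra.{w} (LinearMap.range j.toLinearMap)) := by
  have h := isRationalSystem_finiteDual hA
  refine ⟨existsUnique_coalgebra_finiteDual hA, fun H _ _ hH => exists_bialgebra_finiteDual hH,
    fun H _ _ hH => exists_hopfAlgebra_finiteDual hH, fun B _ _ hB φ => ⟨fun f hf =>
    comp_algHom_mem_finiteDual φ hf, fun hcA hcB => ?_⟩, fun hc C hC => ⟨?_, fun hC' => ?_⟩,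
    fun hc C _ _ _ β hβ => ?_⟩
  · obtain ⟨ψ, hψ⟩ := IsDualCoalgebra.exists_coalgHom (X := finiteDual R A)
      (Y := finiteDual R B) hcA hcB h φ
      ((LinearMap.lcomp R R φ.toLinearMap).restrict fun _ hf => comp_algHom_mem_finiteDual φ hf)
      fun y a => rfl
    exact ⟨ψ, fun f => congrArg Subtype.val (hψ f)⟩
  · exact IsSubcoalgebra.existsUnique_coalgebra (X := finiteDual R A) h hc hC
  · exact IsSubcoalgebra.isRationalPairing (X := finiteDual R A) h hc hC hC'
  · obtain ⟨j, hj, hinj, hsub⟩ := IsRationalPairing.exists_coalgHom (X := finiteDual R A) h hc hβ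
      (β.codRestrict _ hβ.mem_finiteDual) fun c => rfl
    exact ⟨j, fun c => congrArg Subtype.val (hj c), hinj, hsub⟩
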